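/- Let $W:\mathbb{R}\to\mathbb{R}$ be measurable, bounded and $1$-periodic. Let $f:\mathbb{R}\to\mathbb{R}$ be measurable with $c\,\chi_J\le f\le C\,\chi_{[0,1]}$ for some constants $C\ge c>0$ and some non-trivial interval $J\subset[0,1]$. Let $\mu$ be a Borel probability measure on $\mathbb{R}$ whose support $\operatorname{supp}\mu$ is not a discrete set. (These are the data of the continuum one-dimensional Anderson model $-\frac{d^2}{dx^2}+W+\sum_{n\in\mathbb{Z}}\eta_n f(\cdot-n)$ with i.i.d. coupling constants $\eta_n$ of distribution $\mu$.) For $\eta,E\in\mathbb{R}$ let $T(\eta,E)\in SL(2,\mathbb{R})$ be the transfer matrix from $0$ to $1$, that is, the matrix with $$T(\eta,E)\begin{pmatrix}u(0)\\u'(0)\end{pmatrix}=\begin{pmatrix}u(1)\\u'(1)\end{pmatrix}$$ for all solutions $u$ (with $u,u'$ absolutely continuous) of $-u''+Wu+\eta fu=Eu$ on $[0,1]$. Let the Furstenberg group $G(E)$ be the closed subgroup of $SL(2,\mathbb{R})$ generated by the matrices $T(\eta,E)$, $\eta\in\operatorname{supp}\mu$. Then for every $E\in\mathbb{R}$ the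 group $G(E)$ is non-compact and strongly irreducible, the latter meaning that there is no finite non-empty family $V_1,\dots,V_k$ of subspaces of $\mathbb{R}^2$, all different from $\{0\}$ and $\mathbb{R}^2$, such that $A(V_1\cup\dots\cup V_k)=V_1\cup\dots\cup V_k$ for all $A\in G(E)$. -/

import Mathlib

open MeasureTheory Matrix

/-- `u` is a solution on `[0,1]` of `-u'' + q u = 0`, with `p` as its derivative: `u` and `p` are
absolutely continuous, and `u' = p`, `p' = q u` almost everywhere. (As `p` is continuous, `u` is
then `C¹` on `[0,1]` with derivative `p` everywhere, one-sided at the endpoints.) -/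
structure IsSolutionOnUnitInterval (q u p : ℝ → ℝ) : Prop where
  ac_u : AbsolutelyContinuousOnInterval u 0 1
  ac_p : AbsolutelyContinuousOnInterval p 0 1
  deriv_u : ∀ᵐ x : ℝ, x ∈ Set.Icc (0 : ℝ) 1 → HasDerivAt u (p x) x
  deriv_p : ∀ᵐ x : ℝ, x ∈ Set.Icc (0 : ℝ) 1 → HasDerivAt p (q x * u x) x

/-- `T` is the transfer matrix from `0` to `1` of `-u'' + q u = 0`: there is a solution with
`(u(0), u'(0)) = v` and `(u(1), u'(1)) = w` exactly when `w = T v`. -/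
def IsTransferMatrix (q : ℝ → ℝ) (T : Matrix (Fin 2) (Fin 2) ℝ) : Prop :=
  ∀ v w : Fin 2 → ℝ,
    (∃ u p : ℝ → ℝ, IsSolutionOnUnitInterval q u p ∧ ![u 0, p 0] = v ∧ ![u 1, p 1] = w) ↔
      T *ᵥ v = w

/-- The Furstenberg group at energy `E`: the closed subgroup of `SL(2,ℝ)` generated by the transfer
matrices of `-u'' + W u + η f u = E u` from `0` to `1`, with `η` in the support of `μ`. -/
noncomputable def furstenbergGroup (W f : ℝ → ℝ) (μ : Measure ℝ) (E : ℝ) :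
    Subgroup (SpecialLinearGroup (Fin 2) ℝ) :=
  (Subgroup.closure {T : SpecialLinearGroup (Fin 2) ℝ |
    ∃ η ∈ μ.support, IsTransferMatrix (fun x => W x + η * f x - E)
      (T : Matrix (Fin 2) (Fin 2) ℝ)}).topologicalClosure

/-- A set `S` of matrices in `SL(2,ℝ)` is strongly irreducible if there is no finite non-empty
family of subspaces of `ℝ²`, all different from `0` and `ℝ²`, whose union is mapped onto itself by
every element of `S`. -/
def IsStronglyIrreducible (S : Set (SpecialLinearGroup (Fin 2) ℝ)) : Prop :=
  ¬ ∃ F : Set (Submodule ℝ (Fin 2 → ℝ)), F.Finite ∧ F.Nonempty ∧ (∀ V ∈ F, V ≠ ⊥ ∧ V ≠ ⊤) ∧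
    ∀ A ∈ S, (fun x : Fin 2 → ℝ => (A : Matrix (Fin 2) (Fin 2) ℝ) *ᵥ x) ''
      (⋃ V ∈ F, (V : Set (Fin 2 → ℝ))) = ⋃ V ∈ F, (V : Set (Fin 2 → ℝ))

/-!
By Picard iteration the solution of `-u'' + (g + z h) u = 0` with given Cauchy data at `0` is an
entire function of `z` of order at most `1/2`. This growth is seen by weighing the Volterra operator
with `exp (2 ∫₀ˣ φ)`, the double integration giving back a square root of the coupling constant.

If the Furstenberg group were compact, it would preserve a positive definite quadratic form, so
this form would be constant along the first rows of the transfer matrices, for `η` in the support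
of `μ` and then, by the identity theorem at an accumulation point, for all real `η`. The entries of
these rows are thus bounded on the real axis, and an entire function of order less than `1` with
this property is constant by the Phragmén-Lindelöf principle. But the Wronskian identity
`u v' - u' v = const + (η' - η) ∫ h u v` for solutions `u`, `v` with couplings `η`, `η'` shows that,
for `h ≥ 0` and any `x ≠ 0`, the direction of `T(η) x` moves strictly as `η` varies near a given
point, whereas a vector annihilated by the constant first row would have a fixed image direction.

The same strict movement near an accumulation point of the support excludes an invariant finite
union of lines: by continuity `T(η) x` avoids the lines that do not contain `T(η₀) x`, and by the
movement it leaves the one that does.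
-/

section Primitive

variable {𝕜 : Type*} [RCLike 𝕜] {q g h : ℝ → 𝕜}

theorem uIcc_zero_subset {x : ℝ} (hx : x ∈ Set.Icc (0 : ℝ) 1) : Set.uIcc 0 x ⊆ Set.uIcc 0 1 :=
  Set.uIcc_subset_uIcc_left (Set.Icc_subset_uIcc hx)

theorem intervalIntegrable_mul_IccExtend (hq : IntervalIntegrable q volume 0 1)
    (u : C(unitInterval, 𝕜)) {x : ℝ} (hx : x ∈ Set.Icc (0 : ℝ) 1) :
    IntervalIntegrable (fun t => q t * Set.IccExtend zero_le_one u t) volume 0 x :=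
  (hq.mono_set (uIcc_zero_subset hx)).mul_continuousOn u.continuous.Icc_extend'.continuousOn

theorem norm_integral_mul_IccExtend_le {φ : ℝ → ℝ} (u : C(unitInterval, 𝕜))
    (hφ : IntervalIntegrable φ volume 0 1)
    (hu : ∀ t : unitInterval, ‖q t‖ * ‖u t‖ ≤ φ t) {x : ℝ} (hx : x ∈ Set.Icc (0 : ℝ) 1) :
    ‖∫ t in (0 : ℝ)..x, q t * Set.IccExtend zero_le_one u t‖ ≤ ∫ t in (0 : ℝ)..x, φ t := by
  refine intervalIntegral.norm_integral_le_of_norm_le hx.1 (.of_forall fun t ht => ?_)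
    (hφ.mono_set (uIcc_zero_subset hx))
  have ht' : t ∈ Set.Icc (0 : ℝ) 1 := ⟨ht.1.le, ht.2.trans hx.2⟩
  rw [norm_mul, Set.IccExtend_of_mem _ _ ht']
  exact hu ⟨t, ht'⟩

theorem integral_zero_le_integral_zero_one {φ : ℝ → ℝ} {x : ℝ} (hx : x ∈ Set.Icc (0 : ℝ) 1)
    (hφ₀ : ∀ t, 0 ≤ φ t) (hφ : IntervalIntegrable φ volume 0 1) :
    ∫ t in (0 : ℝ)..x, φ t ≤ ∫ t in (0 : ℝ)..1, φ t :=
  intervalIntegral.integral_mono_interval le_rfl hx.1 hx.2 (.of_forall hφ₀) hφ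

/-- The operator `u ↦ ∫₀ˣ q u` on `C([0,1])`, for an integrable function `q`. -/
noncomputable def primitiveMul (q : ℝ → 𝕜) (hq : IntervalIntegrable q volume 0 1) :
    C(unitInterval, 𝕜) →L[𝕜] C(unitInterval, 𝕜) :=
  LinearMap.mkContinuous
    { toFun u :=
        { toFun x := ∫ t in (0 : ℝ)..x, q t * Set.IccExtend zero_le_one u t
          continuous_toFun := by
            have h := intervalIntegral.continuousOn_primitive_interval'
              (intervalIntegrable_mul_IccExtend hq u (Set.right_mem_Icc.2 zero_le_one))
              Set.left_mem_uIcc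
            rw [Set.uIcc_of_le zero_le_one] at h
            exact h.domRestrict }
      map_add' u v := by
        ext x
        have h (w : C(unitInterval, 𝕜)) := intervalIntegrable_mul_IccExtend hq w x.2
        simp only [ContinuousMap.coe_mk, ContinuousMap.add_apply, Set.IccExtend_apply, mul_add]
        exact intervalIntegral.integral_add (h u) (h v)
      map_smul' a u := by
        ext x
        simp only [ContinuousMap.coe_mk, ContinuousMap.smul_apply, Set.IccExtend_apply, smul_eq_mul,
          mul_left_comm _ a, RingHom.id_apply]
        exact intervalIntegral.integral_const_mul _ _ }
    (∫ t in (0 : ℝ)..1, ‖q t‖) fun u =>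
      (ContinuousMap.norm_le _ (mul_nonneg (intervalIntegral.integral_nonneg zero_le_one
        fun _ _ => norm_nonneg _) (norm_nonneg _))).2 fun x => by
        refine (norm_integral_mul_IccExtend_le u (hq.norm.mul_const ‖u‖) (fun t => ?_) x.2).trans ?_
        · exact mul_le_mul_of_nonneg_left (u.norm_coe_le_norm t) (norm_nonneg _)
        · rw [intervalIntegral.integral_mul_const]
          exact mul_le_mul_of_nonneg_right (integral_zero_le_integral_zero_one x.2
            (fun t => norm_nonneg _) hq.norm) (norm_nonneg _)

theorem primitiveMul_apply (hq : IntervalIntegrable q volume 0 1) (u : C(unitInterval, 𝕜))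
    (x : unitInterval) :
    primitiveMul q hq u x = ∫ t in (0 : ℝ)..x, q t * Set.IccExtend zero_le_one u t :=
  rfl

theorem primitiveMul_add_const_mul (hg : IntervalIntegrable g volume 0 1)
    (hh : IntervalIntegrable h volume 0 1) (z : 𝕜) :
    primitiveMul (fun t => g t + z * h t) (hg.add (hh.const_mul z)) =
      primitiveMul g hg + z • primitiveMul h hh := by
  ext u x
  simp only [_root_.add_apply, _root_.smul_apply,
    ContinuousMap.add_apply, ContinuousMap.smul_apply, primitiveMul_apply, smul_eq_mul,
    ← intervalIntegral.integral_const_mul, add_mul, mul_assoc]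
  exact intervalIntegral.integral_add (intervalIntegrable_mul_IccExtend hg u x.2)
    ((intervalIntegrable_mul_IccExtend hh u x.2).const_mul z)

end Primitive

section NeumannSeries

theorem isUnit_one_sub_and_norm_inverse_le_of_norm_pow_le {R : Type*} [NormedRing R]
    [CompleteSpace R] {a : R} {N θ : ℝ} (hθ₀ : 0 ≤ θ) (hθ₁ : θ < 1)
    (ha : ∀ n, ‖a ^ n‖ ≤ N * θ ^ n) :
    IsUnit (1 - a) ∧ ‖Ring.inverse (1 - a)‖ ≤ N * (1 - θ)⁻¹ := by
  have hgeom := (hasSum_geometric_of_lt_one hθ₀ hθ₁).mul_left N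
  have hsum : Summable fun n => a ^ n := .of_norm_bounded hgeom.summable ha
  let unit : Rˣ := ⟨1 - a, ∑' n, a ^ n, hsum.one_sub_mul_tsum_pow, hsum.tsum_pow_mul_one_sub⟩
  refine ⟨unit.isUnit, ?_⟩
  change ‖Ring.inverse (unit : R)‖ ≤ _
  rw [Ring.inverse_unit]
  exact tsum_of_norm_bounded hgeom ha

theorem differentiable_inverse_one_sub_add_smul {𝕜 R : Type*} [NontriviallyNormedField 𝕜]
    [NormedRing R] [CompleteSpace R] [NormedAlgebra 𝕜 R] {a b : R}
    (hunit : ∀ z : 𝕜, IsUnit (1 - (a + z • b))) :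
    Differentiable 𝕜 fun z : 𝕜 => Ring.inverse (1 - (a + z • b)) := fun z => by
  have hinner : DifferentiableAt 𝕜 (fun z : 𝕜 => 1 - (a + z • b)) z := by fun_prop
  exact (differentiableAt_inverse (hunit z)).comp z hinner

theorem norm_pow_le_of_weighted_bound {𝕜 K : Type*} [RCLike 𝕜] [TopologicalSpace K] [CompactSpace K]
    {A : C(K, 𝕜) →L[𝕜] C(K, 𝕜)} {g : K → ℝ} {N θ : ℝ} (hN : 0 ≤ N) (hθ : 0 ≤ θ)
    (hg : ∀ x, g x ∈ Set.Icc 1 N)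
    (hA : ∀ u M, (∀ x, ‖u x‖ ≤ M * g x) → ∀ x, ‖A u x‖ ≤ θ * M * g x) (n : ℕ) :
    ‖A ^ n‖ ≤ N * θ ^ n := by
  refine ContinuousLinearMap.opNorm_le_bound _ (by positivity) fun u => ?_
  have hpow : ∀ x, ‖(A ^ n) u x‖ ≤ θ ^ n * ‖u‖ * g x := by
    induction n with
    | zero =>
      intro x
      simpa using (u.norm_coe_le_norm x).trans (le_mul_of_one_le_right (norm_nonneg u) (hg x).1)
    | succ n ih =>
      rw [pow_succ', pow_succ', mul_assoc θ]
      exact hA _ _ ih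
  refine (ContinuousMap.norm_le _ (by positivity)).2 fun x => (hpow x).trans ?_
  calc θ ^ n * ‖u‖ * g x ≤ θ ^ n * ‖u‖ * N := by gcongr; exact (hg x).2
    _ = N * θ ^ n * ‖u‖ := by ring

end NeumannSeries

section ExponentialWeight

variable {φ : ℝ → ℝ}

theorem lipschitzOnWith_comp_absolutelyContinuousOnInterval {X Y : Type*} [PseudoMetricSpace X]
    [PseudoMetricSpace Y] {F : X → Y} {f : ℝ → X} {a b : ℝ} {K : NNReal}
    (hF : LipschitzOnWith K F (f '' Set.uIcc a b)) (hf : AbsolutelyContinuousOnInterval f a b) :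
    AbsolutelyContinuousOnInterval (F ∘ f) a b := by
  have hlim := Filter.Tendsto.const_mul (K : ℝ) hf
  rw [mul_zero] at hlim
  refine squeeze_zero' (.of_forall fun E => Finset.sum_nonneg fun _ _ => dist_nonneg) ?_ hlim
  filter_upwards [Filter.mem_inf_of_right (Filter.mem_principal_self _)] with E hE
  rw [Finset.mul_sum]
  exact Finset.sum_le_sum fun i hi => hF.dist_le_mul _ (Set.mem_image_of_mem f (hE.1 i hi).1) _
    (Set.mem_image_of_mem f (hE.1 i hi).2)

theorem absolutelyContinuousOnInterval_exp_comp {f : ℝ → ℝ} {a b : ℝ}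
    (hf : AbsolutelyContinuousOnInterval f a b) :
    AbsolutelyContinuousOnInterval (Real.exp ∘ f) a b := by
  obtain ⟨C, hC⟩ := hf.exists_bound
  obtain ⟨K, hK⟩ := Real.contDiff_exp.contDiffOn.exists_lipschitzOnWith (n := 1) (by decide)
    (convex_Icc (-C) C) isCompact_Icc
  refine lipschitzOnWith_comp_absolutelyContinuousOnInterval (hK.mono ?_) hf
  rintro _ ⟨t, ht, rfl⟩
  exact abs_le.1 (hC t ht)

/-- The weight `exp (2 ∫₀ˣ φ)`, in whose sup norm the operator `u ↦ ∫₀ˣ φ u` has norm at most `1/2`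
(Bielecki's trick). -/
noncomputable def expWeight (φ : ℝ → ℝ) (x : ℝ) : ℝ := Real.exp (2 * ∫ t in (0 : ℝ)..x, φ t)

theorem absolutelyContinuousOnInterval_expWeight (hφ : IntervalIntegrable φ volume 0 1) :
    AbsolutelyContinuousOnInterval (expWeight φ) 0 1 :=
  absolutelyContinuousOnInterval_exp_comp ((hφ.absolutelyContinuousOnInterval_intervalIntegral
    Set.left_mem_uIcc).const_mul 2)

theorem integral_mul_expWeight_le (hφ : IntervalIntegrable φ volume 0 1) {x : ℝ}
    (hx : x ∈ Set.Icc (0 : ℝ) 1) :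
    ∫ t in (0 : ℝ)..x, φ t * expWeight φ t ≤ expWeight φ x / 2 := by
  have h_deriv : ∀ᵐ t : ℝ, t ∈ Set.uIoc 0 x →
      deriv (expWeight φ) t = 2 * (φ t * expWeight φ t) := by
    filter_upwards [hφ.ae_hasDerivAt_integral] with t ht htx
    have := ht (uIcc_zero_subset hx (Set.uIoc_subset_uIcc htx)) 0 Set.left_mem_uIcc
    refine ((this.const_mul 2).exp).deriv.trans ?_
    rw [expWeight]
    ring
  have hFTC := ((absolutelyContinuousOnInterval_expWeight hφ).mono
    (uIcc_zero_subset hx)).integral_deriv_eq_sub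
  rw [intervalIntegral.integral_congr_ae h_deriv, intervalIntegral.integral_const_mul] at hFTC
  have h₀ : 0 < expWeight φ 0 := Real.exp_pos _
  linarith

theorem norm_primitiveMul_le_expWeight {𝕜 : Type*} [RCLike 𝕜] {q : ℝ → 𝕜}
    (hq : IntervalIntegrable q volume 0 1) (hφ : IntervalIntegrable φ volume 0 1) {r M : ℝ}
    (hr : 0 ≤ r) (hqφ : ∀ t, ‖q t‖ ≤ r * φ t) {u : C(unitInterval, 𝕜)}
    (hu : ∀ x : unitInterval, ‖u x‖ ≤ M * expWeight φ x) (x : unitInterval) :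
    ‖primitiveMul q hq u x‖ ≤ r * M / 2 * expWeight φ x := by
  have hM : 0 ≤ M := nonneg_of_mul_nonneg_left ((norm_nonneg _).trans (hu x)) (Real.exp_pos _)
  have hint : IntervalIntegrable (fun t => r * M * (φ t * expWeight φ t)) volume 0 1 :=
    (hφ.mul_continuousOn (absolutelyContinuousOnInterval_expWeight hφ).continuousOn).const_mul _
  refine (norm_integral_mul_IccExtend_le u hint (fun t => ?_) x.2).trans ?_
  · calc ‖q t‖ * ‖u t‖ ≤ r * φ t * (M * expWeight φ t) :=
          mul_le_mul (hqφ t) (hu t) (norm_nonneg _) ((norm_nonneg _).trans (hqφ t))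
      _ = r * M * (φ t * expWeight φ t) := by ring
  · rw [intervalIntegral.integral_const_mul]
    calc r * M * ∫ t in (0 : ℝ)..x, φ t * expWeight φ t ≤ r * M * (expWeight φ x / 2) := by
          gcongr; exact integral_mul_expWeight_le hφ x.2
      _ = r * M / 2 * expWeight φ x := by ring

end ExponentialWeight

section Volterra

variable {𝕜 : Type*} [RCLike 𝕜] {q g h : ℝ → 𝕜}

/-- The operator `u ↦ ∫₀ˣ ∫₀ˢ q(t) u(t) dt ds` on `C([0,1])`. -/
noncomputable def volterra (q : ℝ → 𝕜) (hq : IntervalIntegrable q volume 0 1) :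
    C(unitInterval, 𝕜) →L[𝕜] C(unitInterval, 𝕜) :=
  primitiveMul (fun _ => 1) intervalIntegrable_const ∘L primitiveMul q hq

theorem norm_volterra_pow_le (hq : IntervalIntegrable q volume 0 1) {r : ℝ} (hr : 0 < r) (n : ℕ) :
    ‖volterra q hq ^ n‖ ≤ Real.exp (2 * (r + (∫ t in (0 : ℝ)..1, ‖q t‖) / r)) * (1 / 4) ^ n := by
  let φ : ℝ → ℝ := fun t => r + ‖q t‖ / r
  have hφ_nonneg (t : ℝ) : 0 ≤ φ t := by positivity
  have hφ : IntervalIntegrable φ volume 0 1 := intervalIntegrable_const.add (hq.norm.div_const r)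
  have hφ_one : ∫ t in (0 : ℝ)..1, φ t = r + (∫ t in (0 : ℝ)..1, ‖q t‖) / r := by
    rw [intervalIntegral.integral_add intervalIntegrable_const (hq.norm.div_const r),
      intervalIntegral.integral_const, intervalIntegral.integral_div, sub_zero, one_smul]
  rw [← hφ_one]
  refine norm_pow_le_of_weighted_bound (g := fun x : unitInterval => expWeight φ x)
    (Real.exp_pos _).le (by norm_num) (fun x => ⟨?_, ?_⟩) (fun u M hu x => ?_) n
  · exact Real.one_le_exp (mul_nonneg zero_le_two
      (intervalIntegral.integral_nonneg x.2.1 fun t _ => hφ_nonneg t))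
  · exact Real.exp_le_exp.2 (mul_le_mul_of_nonneg_left
      (integral_zero_le_integral_zero_one x.2 hφ_nonneg hφ) zero_le_two)
  · have hqφ (t : ℝ) : ‖q t‖ ≤ r * φ t := by
      simp only [φ, mul_add, mul_div_cancel₀ _ hr.ne']
      nlinarith
    have h1φ (t : ℝ) : ‖(1 : 𝕜)‖ ≤ r⁻¹ * φ t := by
      simp only [φ, mul_add, norm_one, inv_mul_cancel₀ hr.ne', le_add_iff_nonneg_right]
      positivity
    have := norm_primitiveMul_le_expWeight intervalIntegrable_const hφ (inv_nonneg.2 hr.le) h1φ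
      (norm_primitiveMul_le_expWeight hq hφ hr.le hqφ hu) x
    refine this.trans_eq ?_
    field_simp
    ring

theorem isUnit_one_sub_volterra (hq : IntervalIntegrable q volume 0 1) :
    IsUnit (1 - volterra q hq) :=
  (isUnit_one_sub_and_norm_inverse_le_of_norm_pow_le
    (R := C(unitInterval, 𝕜) →L[𝕜] C(unitInterval, 𝕜)) (θ := 1 / 4) (by norm_num) (by norm_num)
    (norm_volterra_pow_le hq one_pos)).1

theorem norm_inverse_one_sub_volterra_le (hq : IntervalIntegrable q volume 0 1) {r : ℝ}
    (hr : 0 < r) :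
    ‖Ring.inverse (1 - volterra q hq)‖ ≤
      Real.exp (2 * (r + (∫ t in (0 : ℝ)..1, ‖q t‖) / r)) * (4 / 3) :=
  (isUnit_one_sub_and_norm_inverse_le_of_norm_pow_le
    (R := C(unitInterval, 𝕜) →L[𝕜] C(unitInterval, 𝕜)) (θ := 1 / 4) (by norm_num) (by norm_num)
    (norm_volterra_pow_le hq hr)).2.trans_eq (by norm_num)

theorem volterra_add_const_mul (hg : IntervalIntegrable g volume 0 1)
    (hh : IntervalIntegrable h volume 0 1) (z : 𝕜) :
    volterra (fun t => g t + z * h t) (hg.add (hh.const_mul z)) =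
      volterra g hg + z • volterra h hh := by
  simp only [volterra, primitiveMul_add_const_mul hg hh, ContinuousLinearMap.comp_add,
    ContinuousLinearMap.comp_smul]

theorem differentiable_inverse_one_sub_volterra (hg : IntervalIntegrable g volume 0 1)
    (hh : IntervalIntegrable h volume 0 1) :
    Differentiable 𝕜 fun z : 𝕜 =>
      Ring.inverse (1 - volterra (fun t => g t + z * h t) (hg.add (hh.const_mul z))) := by
  have hunit (z : 𝕜) := isUnit_one_sub_volterra (hg.add (hh.const_mul z))
  simp only [volterra_add_const_mul hg hh] at hunit ⊢
  exact differentiable_inverse_one_sub_add_smul (𝕜 := 𝕜)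
    (R := C(unitInterval, 𝕜) →L[𝕜] C(unitInterval, 𝕜)) (a := volterra g hg) (b := volterra h hh)
    hunit

end Volterra

section CauchyProblem

variable {𝕜 : Type*} [RCLike 𝕜] {q g h : ℝ → 𝕜}

/-- The free solution `v₀ + v₁ x`, that is, the solution for the potential `0` with Cauchy data `v`
at `0`. -/
noncomputable def freeSolution : (Fin 2 → 𝕜) →ₗ[𝕜] C(unitInterval, 𝕜) :=
  (LinearMap.proj 0).smulRight 1 +
    (LinearMap.proj 1).smulRight (primitiveMul (fun _ => 1) intervalIntegrable_const 1)

/-- The solution on `[0,1]` of `-u'' + q u = 0` with Cauchy data `v = (u(0), u'(0))`, as the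
solution of the integral equation `u - volterra q u = freeSolution v`. -/
noncomputable def cauchySolution (q : ℝ → 𝕜) (hq : IntervalIntegrable q volume 0 1) :
    (Fin 2 → 𝕜) →ₗ[𝕜] C(unitInterval, 𝕜) :=
  (Ring.inverse (1 - volterra q hq)).toLinearMap ∘ₗ freeSolution

/-- The derivative `v₁ + ∫₀ˣ q u` of `u = cauchySolution q hq v`. -/
noncomputable def cauchySolutionDeriv (q : ℝ → 𝕜) (hq : IntervalIntegrable q volume 0 1) :
    (Fin 2 → 𝕜) →ₗ[𝕜] C(unitInterval, 𝕜) :=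
  (LinearMap.proj 1).smulRight 1 + (primitiveMul q hq).toLinearMap ∘ₗ cauchySolution q hq

theorem cauchySolution_eq_iff (hq : IntervalIntegrable q volume 0 1) {v : Fin 2 → 𝕜}
    {u : C(unitInterval, 𝕜)} :
    cauchySolution q hq v = u ↔ u - volterra q hq u = freeSolution v := by
  have hunit := isUnit_one_sub_volterra hq
  have hleft (w) : Ring.inverse (1 - volterra q hq) ((1 - volterra q hq) w) = w :=
    DFunLike.congr_fun (Ring.inverse_mul_cancel _ hunit) w
  have hright (w) : (1 - volterra q hq) (Ring.inverse (1 - volterra q hq) w) = w :=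
    DFunLike.congr_fun (Ring.mul_inverse_cancel _ hunit) w
  constructor
  · rintro rfl
    exact hright _
  · intro h
    change Ring.inverse (1 - volterra q hq) (freeSolution v) = u
    rw [← h]
    exact hleft u

theorem cauchySolutionDeriv_eq (hq : IntervalIntegrable q volume 0 1) (v : Fin 2 → 𝕜) :
    cauchySolutionDeriv q hq v = v 1 • 1 + primitiveMul q hq (cauchySolution q hq v) :=
  rfl

theorem freeSolution_add_volterra (hq : IntervalIntegrable q volume 0 1) (v : Fin 2 → 𝕜)
    (u : C(unitInterval, 𝕜)) :
    freeSolution v + volterra q hq u =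
      v 0 • 1 + primitiveMul (fun _ => 1) intervalIntegrable_const
        (v 1 • 1 + primitiveMul q hq u) := by
  rw [map_add, map_smul, ← add_assoc]
  rfl

theorem cauchySolution_eq (hq : IntervalIntegrable q volume 0 1) (v : Fin 2 → 𝕜) :
    cauchySolution q hq v =
      v 0 • 1 + primitiveMul (fun _ => 1) intervalIntegrable_const
        (cauchySolutionDeriv q hq v) := by
  rw [cauchySolutionDeriv_eq, ← freeSolution_add_volterra]
  exact sub_eq_iff_eq_add.1 ((cauchySolution_eq_iff hq).1 rfl)

theorem eq_cauchySolution (hq : IntervalIntegrable q volume 0 1) {v : Fin 2 → 𝕜}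
    {u p : C(unitInterval, 𝕜)}
    (hu : u = v 0 • 1 + primitiveMul (fun _ => 1) intervalIntegrable_const p)
    (hp : p = v 1 • 1 + primitiveMul q hq u) :
    u = cauchySolution q hq v ∧ p = cauchySolutionDeriv q hq v := by
  have huv : cauchySolution q hq v = u := by
    rw [cauchySolution_eq_iff, sub_eq_iff_eq_add, freeSolution_add_volterra, ← hp, ← hu]
  exact ⟨huv.symm, by rw [cauchySolutionDeriv_eq, huv, ← hp]⟩

theorem differentiable_cauchySolution (hg : IntervalIntegrable g volume 0 1)
    (hh : IntervalIntegrable h volume 0 1) (v : Fin 2 → 𝕜) :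
    Differentiable 𝕜 fun z : 𝕜 =>
      cauchySolution (fun t => g t + z * h t) (hg.add (hh.const_mul z)) v :=
  (differentiable_inverse_one_sub_volterra hg hh).clm_apply (differentiable_const _)

theorem differentiable_cauchySolutionDeriv (hg : IntervalIntegrable g volume 0 1)
    (hh : IntervalIntegrable h volume 0 1) (v : Fin 2 → 𝕜) :
    Differentiable 𝕜 fun z : 𝕜 =>
      cauchySolutionDeriv (fun t => g t + z * h t) (hg.add (hh.const_mul z)) v := by
  have hu := differentiable_cauchySolution hg hh v
  simp only [cauchySolutionDeriv_eq, primitiveMul_add_const_mul hg hh, _root_.add_apply,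
    _root_.smul_apply]
  exact (differentiable_const _).add (((differentiable_const _).clm_apply hu).add
    (differentiable_id.smul ((differentiable_const _).clm_apply hu)))

theorem norm_cauchySolution_le (hq : IntervalIntegrable q volume 0 1) (v : Fin 2 → 𝕜) {r : ℝ}
    (hr : 0 < r) :
    ‖cauchySolution q hq v‖ ≤
      4 / 3 * ‖freeSolution v‖ * Real.exp (2 * (r + (∫ t in (0 : ℝ)..1, ‖q t‖) / r)) :=
  calc ‖Ring.inverse (1 - volterra q hq) (freeSolution v)‖
      ≤ ‖Ring.inverse (1 - volterra q hq)‖ * ‖freeSolution v‖ := ContinuousLinearMap.le_opNorm _ _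
    _ ≤ Real.exp (2 * (r + (∫ t in (0 : ℝ)..1, ‖q t‖) / r)) * (4 / 3) * ‖freeSolution v‖ := by
        gcongr; exact norm_inverse_one_sub_volterra_le hq hr
    _ = _ := by ring

theorem norm_cauchySolution_add_mul_le (hg : IntervalIntegrable g volume 0 1)
    (hh : IntervalIntegrable h volume 0 1) (v : Fin 2 → 𝕜) (z : 𝕜) :
    ‖cauchySolution (fun t => g t + z * h t) (hg.add (hh.const_mul z)) v‖ ≤
      4 / 3 * ‖freeSolution v‖ *
        Real.exp (2 * (1 + (∫ t in (0 : ℝ)..1, ‖g t‖) + ∫ t in (0 : ℝ)..1, ‖h t‖) *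
          (1 + √‖z‖)) := by
  have hq := hg.add (hh.const_mul z)
  set G := ∫ t in (0 : ℝ)..1, ‖g t‖
  set H := ∫ t in (0 : ℝ)..1, ‖h t‖
  have hG : 0 ≤ G := intervalIntegral.integral_nonneg zero_le_one fun _ _ => norm_nonneg _
  have hH : 0 ≤ H := intervalIntegral.integral_nonneg zero_le_one fun _ _ => norm_nonneg _
  have hr : 0 < 1 + √‖z‖ := by positivity
  have hint : ∫ t in (0 : ℝ)..1, ‖g t + z * h t‖ ≤ G + ‖z‖ * H := by
    rw [← intervalIntegral.integral_const_mul, ← intervalIntegral.integral_add hg.norm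
      (hh.norm.const_mul _)]
    refine intervalIntegral.integral_mono_on zero_le_one hq.norm
      (hg.norm.add (hh.norm.const_mul _)) fun t _ => ?_
    rw [← norm_mul]
    exact norm_add_le _ _
  have hquot : (G + ‖z‖ * H) / (1 + √‖z‖) ≤ (G + H) * (1 + √‖z‖) := by
    rw [div_le_iff₀ hr]
    nlinarith [mul_nonneg hG (Real.sqrt_nonneg ‖z‖), mul_nonneg hH (Real.sqrt_nonneg ‖z‖),
      Real.sq_sqrt (norm_nonneg z), mul_nonneg hG (norm_nonneg z)]
  refine (norm_cauchySolution_le hq v hr).trans ?_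
  refine mul_le_mul_of_nonneg_left (Real.exp_le_exp.2 ?_) (by positivity)
  calc 2 * (1 + √‖z‖ + (∫ t in (0 : ℝ)..1, ‖g t + z * h t‖) / (1 + √‖z‖))
      ≤ 2 * (1 + √‖z‖ + (G + ‖z‖ * H) / (1 + √‖z‖)) := by gcongr
    _ ≤ 2 * (1 + √‖z‖ + (G + H) * (1 + √‖z‖)) := by gcongr
    _ = 2 * (1 + G + H) * (1 + √‖z‖) := by ring

theorem isBigO_cauchySolution_add_mul (hg : IntervalIntegrable g volume 0 1)
    (hh : IntervalIntegrable h volume 0 1) (v : Fin 2 → 𝕜) : ∃ B : ℝ,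
    (fun z => cauchySolution (fun t => g t + z * h t) (hg.add (hh.const_mul z)) v) =O[⊤]
      fun z => Real.exp (B * ‖z‖ ^ (1 / 2 : ℝ)) := by
  set k := 2 * (1 + (∫ t in (0 : ℝ)..1, ‖g t‖) + ∫ t in (0 : ℝ)..1, ‖h t‖)
  refine ⟨k, .of_bound (4 / 3 * ‖freeSolution v‖ * Real.exp k) (.of_forall fun z =>
    (norm_cauchySolution_add_mul_le hg hh v z).trans_eq ?_)⟩
  rw [Real.norm_of_nonneg (Real.exp_nonneg _), ← Real.sqrt_eq_rpow, mul_assoc _ (Real.exp _),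
    ← Real.exp_add, ← mul_one_add]

end CauchyProblem

section Complexification

variable {q : ℝ → ℝ}

/-- A real-valued continuous function on `[0,1]`, viewed as a complex-valued one. -/
noncomputable def complexify (u : C(unitInterval, ℝ)) : C(unitInterval, ℂ) :=
  ⟨fun x => u x, Complex.continuous_ofReal.comp u.continuous⟩

theorem intervalIntegrable_ofReal {a b : ℝ} (hq : IntervalIntegrable q volume a b) :
    IntervalIntegrable (fun t => (q t : ℂ)) volume a b :=
  ⟨hq.1.ofReal, hq.2.ofReal⟩

theorem complexify_primitiveMul (hq : IntervalIntegrable q volume 0 1) (u : C(unitInterval, ℝ)) :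
    complexify (primitiveMul q hq u) =
      primitiveMul (fun t => (q t : ℂ)) (intervalIntegrable_ofReal hq) (complexify u) := by
  ext x
  change ((∫ t in (0 : ℝ)..x, q t * Set.IccExtend zero_le_one u t : ℝ) : ℂ) = _
  rw [← intervalIntegral.integral_ofReal]
  exact intervalIntegral.integral_congr fun t _ => Complex.ofReal_mul _ _

theorem complexify_smul_one_add_primitiveMul (hq : IntervalIntegrable q volume 0 1) (a : ℝ)
    (u : C(unitInterval, ℝ)) :
    complexify (a • 1 + primitiveMul q hq u) =
      (a : ℂ) • 1 +
        primitiveMul (fun t => (q t : ℂ)) (intervalIntegrable_ofReal hq) (complexify u) := by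
  rw [← complexify_primitiveMul hq]
  ext x
  simp [complexify]

theorem complexify_cauchySolution (hq : IntervalIntegrable q volume 0 1) (v : Fin 2 → ℝ) :
    complexify (cauchySolution q hq v) =
      cauchySolution (fun t => (q t : ℂ)) (intervalIntegrable_ofReal hq) fun i => (v i : ℂ) := by
  refine (eq_cauchySolution (intervalIntegrable_ofReal hq)
    (p := complexify (cauchySolutionDeriv q hq v)) ?_ ?_).1
  · conv_lhs => rw [cauchySolution_eq, complexify_smul_one_add_primitiveMul]
    simp only [Complex.ofReal_one]
  · rw [cauchySolutionDeriv_eq, complexify_smul_one_add_primitiveMul]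

end Complexification

section Solutions

variable {q q₁ q₂ h : ℝ → ℝ}

theorem integral_eq_sub_of_ae_hasDerivAt {F f : ℝ → ℝ} {a b : ℝ}
    (hF : AbsolutelyContinuousOnInterval F a b)
    (hderiv : ∀ᵐ x, x ∈ Set.uIoc a b → HasDerivAt F (f x) x) :
    ∫ x in a..b, f x = F b - F a := by
  rw [← hF.integral_deriv_eq_sub]
  refine intervalIntegral.integral_congr_ae ?_
  filter_upwards [hderiv] with x hx hxab using (hx hxab).deriv.symm

theorem integral_eq_sub_zero_of_ae_hasDerivAt {F f : ℝ → ℝ}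
    (hF : AbsolutelyContinuousOnInterval F 0 1)
    (hderiv : ∀ᵐ x : ℝ, x ∈ Set.Icc (0 : ℝ) 1 → HasDerivAt F (f x) x) (x : unitInterval) :
    ∫ t in (0 : ℝ)..x, f t = F x - F 0 := by
  have hsub := uIcc_zero_subset x.2
  refine integral_eq_sub_of_ae_hasDerivAt (hF.mono hsub) ?_
  filter_upwards [hderiv] with t ht htx
  exact ht (Set.uIcc_of_le (zero_le_one' ℝ) ▸ hsub (Set.uIoc_subset_uIcc htx))

theorem primitiveMul_domRestrict (hq : IntervalIntegrable q volume 0 1) {u : ℝ → ℝ}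
    (hu : ContinuousOn u (Set.Icc 0 1)) (x : unitInterval) :
    primitiveMul q hq ⟨_, hu.domRestrict⟩ x = ∫ t in (0 : ℝ)..x, q t * u t := by
  refine intervalIntegral.integral_congr fun t ht => ?_
  have ht01 : t ∈ Set.Icc (0 : ℝ) 1 :=
    Set.uIcc_of_le (zero_le_one' ℝ) ▸ uIcc_zero_subset x.2 ht
  simp only [ContinuousMap.coe_mk, Set.IccExtend_of_mem _ _ ht01, Set.domRestrict_apply]

theorem IsSolutionOnUnitInterval.eq_cauchySolution {u p : ℝ → ℝ}
    (hs : IsSolutionOnUnitInterval q u p) (hq : IntervalIntegrable q volume 0 1)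
    (x : unitInterval) :
    u x = cauchySolution q hq ![u 0, p 0] x ∧ p x = cauchySolutionDeriv q hq ![u 0, p 0] x := by
  have hu : ContinuousOn u (Set.Icc 0 1) := by simpa using hs.ac_u.continuousOn
  have hp : ContinuousOn p (Set.Icc 0 1) := by simpa using hs.ac_p.continuousOn
  have hu' (y : unitInterval) : u y = u 0 +
      primitiveMul (fun _ => 1) intervalIntegrable_const ⟨_, hp.domRestrict⟩ y := by
    rw [primitiveMul_domRestrict _ hp]
    simp only [one_mul, integral_eq_sub_zero_of_ae_hasDerivAt hs.ac_u hs.deriv_u y,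
      add_sub_cancel]
  have hp' (y : unitInterval) : p y = p 0 + primitiveMul q hq ⟨_, hu.domRestrict⟩ y := by
    rw [primitiveMul_domRestrict _ hu, integral_eq_sub_zero_of_ae_hasDerivAt hs.ac_p hs.deriv_p y,
      add_sub_cancel]
  have hsol := _root_.eq_cauchySolution hq (v := ![u 0, p 0]) (u := ⟨_, hu.domRestrict⟩)
    (p := ⟨_, hp.domRestrict⟩) (by ext y; simpa using hu' y) (by ext y; simpa using hp' y)
  exact ⟨DFunLike.congr_fun hsol.1 x, DFunLike.congr_fun hsol.2 x⟩

theorem absolutelyContinuousOnInterval_const_add_integral {φ : ℝ → ℝ} (a : ℝ)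
    (hφ : IntervalIntegrable φ volume 0 1) :
    AbsolutelyContinuousOnInterval (fun x => a + ∫ t in (0 : ℝ)..x, φ t) 0 1 :=
  ((LipschitzWith.const a).lipschitzOnWith.absolutelyContinuousOnInterval).add
    (hφ.absolutelyContinuousOnInterval_intervalIntegral (c := 0) (by simp))

theorem exists_isSolutionOnUnitInterval (hq : IntervalIntegrable q volume 0 1) (v : Fin 2 → ℝ) :
    ∃ u p : ℝ → ℝ, IsSolutionOnUnitInterval q u p ∧
      (∀ x : unitInterval, HasDerivAt u (p x) x) ∧
      ∀ x : unitInterval, u x = cauchySolution q hq v x ∧ p x = cauchySolutionDeriv q hq v x := by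
  set û := Set.IccExtend zero_le_one (cauchySolution q hq v)
  set p' := Set.IccExtend zero_le_one (cauchySolutionDeriv q hq v)
  have hp'_cont : Continuous p' := (cauchySolutionDeriv q hq v).continuous.Icc_extend'
  have hqû : IntervalIntegrable (fun t => q t * û t) volume 0 1 :=
    intervalIntegrable_mul_IccExtend hq _ (Set.right_mem_Icc.2 zero_le_one)
  have hu (x : unitInterval) : v 0 + ∫ t in (0 : ℝ)..x, p' t = cauchySolution q hq v x := by
    conv_rhs => rw [cauchySolution_eq]
    simp [primitiveMul_apply, p']
  have hp (x : unitInterval) :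
      v 1 + ∫ t in (0 : ℝ)..x, q t * û t = cauchySolutionDeriv q hq v x := by
    simp [cauchySolutionDeriv_eq, primitiveMul_apply, û]
  have hderiv (x : unitInterval) : HasDerivAt (fun y => v 0 + ∫ t in (0 : ℝ)..y, p' t)
      (v 1 + ∫ t in (0 : ℝ)..x, q t * û t) x := by
    rw [hp, ← Set.IccExtend_val zero_le_one (cauchySolutionDeriv q hq v) x]
    exact (hp'_cont.integral_hasStrictDerivAt 0 x).hasDerivAt.const_add _
  refine ⟨fun x => v 0 + ∫ t in (0 : ℝ)..x, p' t, fun x => v 1 + ∫ t in (0 : ℝ)..x, q t * û t,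
    ⟨absolutelyContinuousOnInterval_const_add_integral _ (hp'_cont.intervalIntegrable _ _),
      absolutelyContinuousOnInterval_const_add_integral _ hqû,
      .of_forall fun x hx => hderiv ⟨x, hx⟩, ?_⟩, hderiv, fun x => ⟨hu x, hp x⟩⟩
  filter_upwards [hqû.ae_hasDerivAt_integral] with x hx hx01
  rw [hu ⟨x, hx01⟩, ← Set.IccExtend_of_mem zero_le_one (cauchySolution q hq v) hx01]
  exact (hx (by simpa using hx01) 0 (by simp)).const_add _

theorem cauchySolution_zero (hq : IntervalIntegrable q volume 0 1) (v : Fin 2 → ℝ) :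
    cauchySolution q hq v 0 = v 0 := by
  simp [cauchySolution_eq, primitiveMul_apply]

theorem cauchySolutionDeriv_zero (hq : IntervalIntegrable q volume 0 1) (v : Fin 2 → ℝ) :
    cauchySolutionDeriv q hq v 0 = v 1 := by
  simp [cauchySolutionDeriv_eq, primitiveMul_apply]

theorem wronskian_cauchySolution (hq₁ : IntervalIntegrable q₁ volume 0 1)
    (hq₂ : IntervalIntegrable q₂ volume 0 1) (v w : Fin 2 → ℝ) (x : unitInterval) :
    cauchySolution q₁ hq₁ v x * cauchySolutionDeriv q₂ hq₂ w x -
        cauchySolutionDeriv q₁ hq₁ v x * cauchySolution q₂ hq₂ w x =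
      v 0 * w 1 - v 1 * w 0 + primitiveMul (fun t => q₂ t - q₁ t) (hq₂.sub hq₁)
        (cauchySolution q₁ hq₁ v * cauchySolution q₂ hq₂ w) x := by
  obtain ⟨u₁, p₁, h₁, -, hc₁⟩ := exists_isSolutionOnUnitInterval hq₁ v
  obtain ⟨u₂, p₂, h₂, -, hc₂⟩ := exists_isSolutionOnUnitInterval hq₂ w
  have hwronskian := integral_eq_sub_zero_of_ae_hasDerivAt
    (F := fun x => u₁ x * p₂ x - p₁ x * u₂ x) (f := fun x => (q₂ x - q₁ x) * (u₁ x * u₂ x))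
    ((h₁.ac_u.mul h₂.ac_p).sub (h₁.ac_p.mul h₂.ac_u)) (by
      filter_upwards [h₁.deriv_u, h₂.deriv_u, h₁.deriv_p, h₂.deriv_p] with t hu₁ hu₂ hp₁ hp₂ ht
      exact (((hu₁ ht).mul (hp₂ ht)).sub ((hp₁ ht).mul (hu₂ ht))).congr_deriv (by ring)) x
  have hintegral : primitiveMul (fun t => q₂ t - q₁ t) (hq₂.sub hq₁)
      (cauchySolution q₁ hq₁ v * cauchySolution q₂ hq₂ w) x =
        ∫ t in (0 : ℝ)..x, (q₂ t - q₁ t) * (u₁ t * u₂ t) := by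
    refine intervalIntegral.integral_congr fun t ht => ?_
    have ht01 : t ∈ Set.Icc (0 : ℝ) 1 :=
      Set.uIcc_of_le (zero_le_one' ℝ) ▸ uIcc_zero_subset x.2 ht
    simp only [Set.IccExtend_of_mem _ _ ht01, ContinuousMap.mul_apply, (hc₁ ⟨t, ht01⟩).1,
      (hc₂ ⟨t, ht01⟩).1]
  have hzero := And.intro (hc₁ 0) (hc₂ 0)
  simp only [cauchySolution_zero, cauchySolutionDeriv_zero, Set.Icc.coe_zero] at hzero
  rw [hintegral, hwronskian, hzero.1.1, hzero.1.2, hzero.2.1, hzero.2.2, (hc₁ x).1, (hc₁ x).2,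
    (hc₂ x).1, (hc₂ x).2]
  ring

theorem wronskian_cauchySolution_self (hq : IntervalIntegrable q volume 0 1) (v w : Fin 2 → ℝ)
    (x : unitInterval) :
    cauchySolution q hq v x * cauchySolutionDeriv q hq w x -
      cauchySolutionDeriv q hq v x * cauchySolution q hq w x = v 0 * w 1 - v 1 * w 0 := by
  simpa [primitiveMul_apply] using wronskian_cauchySolution hq hq v w x

theorem eq_zero_of_cauchySolution_eq_zero (hq : IntervalIntegrable q volume 0 1) {v : Fin 2 → ℝ}
    {x : unitInterval} (hu : cauchySolution q hq v x = 0)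
    (hp : cauchySolutionDeriv q hq v x = 0) : v = 0 := by
  have hwronskian (w : Fin 2 → ℝ) : v 0 * w 1 - v 1 * w 0 = 0 := by
    rw [← wronskian_cauchySolution_self hq v w x, hu, hp, zero_mul, zero_mul, sub_zero]
  ext i
  fin_cases i
  · simpa using hwronskian ![0, 1]
  · simpa using hwronskian ![1, 0]

theorem exists_frequently_mem_of_not_isDiscrete {X : Type*} [TopologicalSpace X] {s : Set X}
    (hs : ¬ IsDiscrete s) : ∃ x ∈ s, ∃ᶠ y in nhdsWithin x {x}ᶜ, y ∈ s := by
  rw [isDiscrete_iff_nhdsNE] at hs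
  push Not at hs
  obtain ⟨x, hx, hne⟩ := hs
  exact ⟨x, hx, Filter.frequently_mem_iff_neBot.2 hne⟩

theorem ae_ne_of_hasDerivAt_ne_zero {u u' : ℝ → ℝ} {s : Set ℝ} {c : ℝ} {μ : Measure ℝ}
    [NullSingletonClass μ] (hderiv : ∀ x ∈ s, HasDerivAt u (u' x) x)
    (hne : ∀ x ∈ s, u x = c → u' x ≠ 0) : ∀ᵐ x ∂μ, x ∈ s → u x ≠ c := by
  have hdiscrete : IsDiscrete {x | x ∈ s ∧ u x = c} := by
    by_contra h
    obtain ⟨x, ⟨hxs, hxc⟩, hfreq⟩ := exists_frequently_mem_of_not_isDiscrete h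
    have hev := (hderiv x hxs).eventually_ne (c := c) (hne x hxs hxc)
    obtain ⟨y, ⟨-, hy⟩, hy'⟩ := (hfreq.and_eventually hev).exists
    exact hy' hy
  have hcountable : {x | x ∈ s ∧ u x = c}.Countable :=
    (HereditarilyLindelofSpace.isLindelof _).countable_of_isDiscrete hdiscrete
  filter_upwards [hcountable.ae_notMem μ] with x hx hxs hxc using hx ⟨hxs, hxc⟩

theorem primitiveMul_sq_cauchySolution_ne_zero (hq : IntervalIntegrable q volume 0 1)
    (hh : IntervalIntegrable h volume 0 1) (hh₀ : 0 ≤ᵐ[volume.restrict (Set.Ioc 0 1)] h)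
    (hhne : ¬ h =ᵐ[volume.restrict (Set.Ioc 0 1)] 0) {v : Fin 2 → ℝ} (hv : v ≠ 0) :
    primitiveMul h hh (cauchySolution q hq v ^ 2) 1 ≠ 0 := by
  obtain ⟨u, p, -, hderiv, hc⟩ := exists_isSolutionOnUnitInterval hq v
  have hu_ne : ∀ᵐ x : ℝ, x ∈ Set.Icc (0 : ℝ) 1 → u x ≠ 0 :=
    ae_ne_of_hasDerivAt_ne_zero (fun x hx => hderiv ⟨x, hx⟩) fun x hx hux hpx =>
      hv (eq_zero_of_cauchySolution_eq_zero hq (x := ⟨x, hx⟩) ((hc _).1 ▸ hux) ((hc _).2 ▸ hpx))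
  refine fun hzero => hhne ?_
  set w := Set.IccExtend zero_le_one ⇑(cauchySolution q hq v ^ 2) with hw
  have hnonneg : 0 ≤ᵐ[volume.restrict (Set.Ioc 0 1)] fun t => h t * w t := by
    filter_upwards [hh₀] with t ht using mul_nonneg ht (sq_nonneg _)
  have hae := (intervalIntegral.integral_eq_zero_iff_of_le_of_nonneg_ae zero_le_one hnonneg
    (intervalIntegrable_mul_IccExtend hh _ (Set.right_mem_Icc.2 zero_le_one))).1 hzero
  filter_upwards [hae, ae_restrict_of_ae hu_ne, ae_restrict_mem measurableSet_Ioc]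
    with t ht hut ht01
  have ht01 : t ∈ Set.Icc (0 : ℝ) 1 := Set.Ioc_subset_Icc_self ht01
  refine (mul_eq_zero.1 ht).resolve_right ?_
  rw [hw, Set.IccExtend_of_mem _ _ ht01, ContinuousMap.pow_apply, ← (hc ⟨t, ht01⟩).1]
  exact pow_ne_zero 2 (hut ht01)

end Solutions

section TransferMatrix

open Filter Topology

variable {q g h : ℝ → ℝ}

theorem linearIndependent_pair_iff_det_ne_zero {K : Type*} [Field K] {x y : Fin 2 → K} :
    LinearIndependent K ![x, y] ↔ x 0 * y 1 - x 1 * y 0 ≠ 0 := by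
  have hdet : (Matrix.of ![x, y]).det = x 0 * y 1 - x 1 * y 0 := by simp [Matrix.det_fin_two]
  rw [← hdet, ← isUnit_iff_ne_zero, ← Matrix.isUnit_iff_isUnit_det,
    ← Matrix.linearIndependent_rows_iff_isUnit]
  rfl

/-- The map taking the Cauchy data of a solution of `-u'' + q u = 0` at `0` to those at `1`. -/
noncomputable def cauchyFlow (q : ℝ → ℝ) (hq : IntervalIntegrable q volume 0 1) :
    (Fin 2 → ℝ) →ₗ[ℝ] Fin 2 → ℝ where
  toFun v := ![cauchySolution q hq v 1, cauchySolutionDeriv q hq v 1]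
  map_add' v w := by simp
  map_smul' c v := by simp

theorem det_toMatrix'_cauchyFlow (hq : IntervalIntegrable q volume 0 1) :
    (LinearMap.toMatrix' (cauchyFlow q hq)).det = 1 := by
  rw [Matrix.det_fin_two]
  simpa [LinearMap.toMatrix'_apply, cauchyFlow, mul_comm] using
    wronskian_cauchySolution_self hq (Pi.single 0 1) (Pi.single 1 1) 1

/-- The transfer matrix from `0` to `1` of `-u'' + q u = 0` as an element of `SL(2,ℝ)`. -/
noncomputable def transferMatrix (q : ℝ → ℝ) (hq : IntervalIntegrable q volume 0 1) :
    SpecialLinearGroup (Fin 2) ℝ :=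
  ⟨LinearMap.toMatrix' (cauchyFlow q hq), det_toMatrix'_cauchyFlow hq⟩

theorem transferMatrix_mulVec (hq : IntervalIntegrable q volume 0 1) (v : Fin 2 → ℝ) :
    (transferMatrix q hq : Matrix (Fin 2) (Fin 2) ℝ) *ᵥ v =
      ![cauchySolution q hq v 1, cauchySolutionDeriv q hq v 1] :=
  LinearMap.toMatrix'_mulVec _ _

theorem isTransferMatrix_transferMatrix (hq : IntervalIntegrable q volume 0 1) :
    IsTransferMatrix q (transferMatrix q hq) := by
  intro v w
  rw [transferMatrix_mulVec]
  constructor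
  · rintro ⟨u, p, hs, rfl, rfl⟩
    rw [← (hs.eq_cauchySolution hq 1).1, ← (hs.eq_cauchySolution hq 1).2]
    rfl
  · rintro rfl
    obtain ⟨u, p, hs, -, hc⟩ := exists_isSolutionOnUnitInterval hq v
    have hzero := hc 0
    have hone := hc 1
    rw [cauchySolution_zero, cauchySolutionDeriv_zero, Set.Icc.coe_zero] at hzero
    rw [Set.Icc.coe_one] at hone
    refine ⟨u, p, hs, ?_, by rw [hone.1, hone.2]⟩
    rw [hzero.1, hzero.2]
    exact FinVec.etaExpand_eq v

/-- The transfer matrix of `-u'' + (g + η h) u = 0` as a function of the coupling constant `η`. -/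
noncomputable def couplingTransferMatrix (hg : IntervalIntegrable g volume 0 1)
    (hh : IntervalIntegrable h volume 0 1) (η : ℝ) : SpecialLinearGroup (Fin 2) ℝ :=
  transferMatrix (fun t => g t + η * h t) (hg.add (hh.const_mul η))

theorem continuous_couplingTransferMatrix_mulVec (hg : IntervalIntegrable g volume 0 1)
    (hh : IntervalIntegrable h volume 0 1) (v : Fin 2 → ℝ) : Continuous fun η =>
      (couplingTransferMatrix hg hh η : Matrix (Fin 2) (Fin 2) ℝ) *ᵥ v := by
  simp only [couplingTransferMatrix, transferMatrix_mulVec]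
  refine continuous_pi fun i => ?_
  fin_cases i
  · exact (continuous_eval_const 1).comp (differentiable_cauchySolution hg hh v).continuous
  · exact (continuous_eval_const 1).comp (differentiable_cauchySolutionDeriv hg hh v).continuous

theorem eventually_linearIndependent_couplingTransferMatrix_mulVec
    (hg : IntervalIntegrable g volume 0 1) (hh : IntervalIntegrable h volume 0 1)
    (hh₀ : 0 ≤ᵐ[volume.restrict (Set.Ioc 0 1)] h)
    (hhne : ¬ h =ᵐ[volume.restrict (Set.Ioc 0 1)] 0) {v : Fin 2 → ℝ} (hv : v ≠ 0) (η₀ : ℝ) :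
    ∀ᶠ η in 𝓝[≠] η₀, LinearIndependent ℝ
      ![(couplingTransferMatrix hg hh η : Matrix (Fin 2) (Fin 2) ℝ) *ᵥ v,
        (couplingTransferMatrix hg hh η₀ : Matrix (Fin 2) (Fin 2) ℝ) *ᵥ v] := by
  set u := fun η : ℝ => cauchySolution (fun t => g t + η * h t) (hg.add (hh.const_mul η)) v
  have hu : Continuous u := (differentiable_cauchySolution hg hh v).continuous
  have hcont : Continuous fun η => primitiveMul h hh (u η * u η₀) 1 :=
    (continuous_eval_const (1 : unitInterval)).comp
      ((primitiveMul h hh).continuous.comp (hu.mul continuous_const))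
  have hne : primitiveMul h hh (u η₀ * u η₀) 1 ≠ 0 := by
    rw [← sq]
    exact primitiveMul_sq_cauchySolution_ne_zero _ hh hh₀ hhne hv
  filter_upwards [(hcont.continuousAt.eventually_ne hne).filter_mono nhdsWithin_le_nhds,
    self_mem_nhdsWithin] with η hη hηη₀
  have hwronskian := wronskian_cauchySolution (hg.add (hh.const_mul η))
    (hg.add (hh.const_mul η₀)) v v 1
  have hfactor : primitiveMul (fun t => g t + η₀ * h t - (g t + η * h t))
      ((hg.add (hh.const_mul η₀)).sub (hg.add (hh.const_mul η))) (u η * u η₀) 1 =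
        (η₀ - η) * primitiveMul h hh (u η * u η₀) 1 := by
    simp only [primitiveMul_apply]
    rw [← intervalIntegral.integral_const_mul]
    exact intervalIntegral.integral_congr fun t _ => by ring
  rw [linearIndependent_pair_iff_det_ne_zero]
  simp only [couplingTransferMatrix, transferMatrix_mulVec, Matrix.cons_val_zero,
    Matrix.cons_val_one]
  rw [hwronskian, hfactor, mul_comm (v 0), sub_self, zero_add]
  exact mul_ne_zero (sub_ne_zero.2 (Ne.symm hηη₀)) hη

end TransferMatrix

section StrongIrreducibility

open Filter Topology

theorem isStronglyIrreducible_of_frequently {X : Type*} [TopologicalSpace X]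
    {T : X → SpecialLinearGroup (Fin 2) ℝ} {x₀ : X} {S : Set (SpecialLinearGroup (Fin 2) ℝ)}
    (hcont : ∀ v : Fin 2 → ℝ, ContinuousAt (fun x => (T x : Matrix (Fin 2) (Fin 2) ℝ) *ᵥ v) x₀)
    (hmove : ∀ v : Fin 2 → ℝ, v ≠ 0 → ∀ᶠ x in 𝓝[≠] x₀, LinearIndependent ℝ
      ![(T x : Matrix (Fin 2) (Fin 2) ℝ) *ᵥ v, (T x₀ : Matrix (Fin 2) (Fin 2) ℝ) *ᵥ v])
    (hfreq : ∃ᶠ x in 𝓝[≠] x₀, T x ∈ S) : IsStronglyIrreducible S := by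
  rintro ⟨F, hF, ⟨V, hV⟩, hproper, hinv⟩
  obtain ⟨v, hvV, hv⟩ := Submodule.exists_mem_ne_zero_of_ne_bot (hproper V hV).1
  have hleave : ∀ L ∈ F, ∀ᶠ x in 𝓝[≠] x₀, (T x : Matrix (Fin 2) (Fin 2) ℝ) *ᵥ v ∉ L := by
    intro L hL
    by_cases hx₀ : (T x₀ : Matrix (Fin 2) (Fin 2) ℝ) *ᵥ v ∈ L
    · filter_upwards [hmove v hv] with x hx hxL
      refine (hproper L hL).2 (top_le_iff.1 ?_)
      rw [← hx.span_eq_top_of_card_eq_finrank (by simp), Submodule.span_le]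
      rintro _ ⟨i, rfl⟩
      fin_cases i
      exacts [hxL, hx₀]
    · exact ((hcont v).eventually
        (L.closed_of_finiteDimensional.isOpen_compl.mem_nhds hx₀)).filter_mono nhdsWithin_le_nhds
  obtain ⟨x, hxS, hx⟩ := (hfreq.and_eventually ((eventually_all_finite hF).2 hleave)).exists
  have hmem : (T x : Matrix (Fin 2) (Fin 2) ℝ) *ᵥ v ∈ ⋃ L ∈ F, (L : Set (Fin 2 → ℝ)) :=
    hinv _ hxS ▸ Set.mem_image_of_mem _ (Set.mem_biUnion hV hvV)
  obtain ⟨L, hL, hxL⟩ := Set.mem_iUnion₂.1 hmem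
  exact hx L hL hxL

end StrongIrreducibility

section CompactGroups

variable {n : Type*} [Fintype n]

theorem linearMap_integral_comm {X V V' : Type*} [MeasurableSpace X] {ν : Measure X}
    [NormedAddCommGroup V] [NormedSpace ℝ V] [FiniteDimensional ℝ V] [NormedAddCommGroup V']
    [NormedSpace ℝ V'] [CompleteSpace V'] (L : V →ₗ[ℝ] V') {φ : X → V} (hφ : Integrable φ ν) :
    L (∫ x, φ x ∂ν) = ∫ x, L (φ x) ∂ν :=
  haveI := FiniteDimensional.complete ℝ V
  (L.toContinuousLinearMap.integral_comp_comm hφ).symm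

open scoped Matrix.Norms.Elementwise in
theorem exists_posDef_mul_mul_transpose_eq [DecidableEq n] {K : Type*} [Group K]
    [TopologicalSpace K] [IsTopologicalGroup K] [CompactSpace K] {ρ : K →* Matrix n n ℝ}
    (hρ : Continuous ρ) : ∃ S : Matrix n n ℝ, S.PosDef ∧ ∀ k, ρ k * S * (ρ k)ᵀ = S := by
  borelize K
  have hcont : Continuous fun k => ρ k * (ρ k)ᵀ := by fun_prop
  have hint := hcont.integrable_of_hasCompactSupport (μ := Measure.haar) (.of_compactSpace _)
  refine ⟨∫ k, ρ k * (ρ k)ᵀ ∂Measure.haar, .of_dotProduct_mulVec_pos ?_ fun x hx => ?_, fun k => ?_⟩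
  · have := linearMap_integral_comm
      (transposeLinearEquiv n n ℝ ℝ : Matrix n n ℝ →ₗ[ℝ] Matrix n n ℝ) hint
    simpa [Matrix.IsHermitian] using this
  · have hquad (k : K) : x ⬝ᵥ (ρ k * (ρ k)ᵀ) *ᵥ x = (x ᵥ* ρ k) ⬝ᵥ (x ᵥ* ρ k) := by
      rw [← mulVec_mulVec, mulVec_transpose, dotProduct_mulVec]
    have hform := linearMap_integral_comm (IsLinearMap.mk' (fun M : Matrix n n ℝ => x ⬝ᵥ M *ᵥ x)
      ⟨by simp [add_mulVec], by simp [smul_mulVec]⟩) hint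
    simp only [IsLinearMap.mk'_apply, hquad] at hform
    rw [star_trivial, hform]
    refine Continuous.integral_pos_of_hasCompactSupport_nonneg_nonzero (x := 1) (by fun_prop)
      (.of_compactSpace _) (fun k => dotProduct_self_star_nonneg _) ?_
    simpa using hx
  · have := linearMap_integral_comm
      ((LinearMap.mulRight ℝ (ρ k)ᵀ).comp (LinearMap.mulLeft ℝ (ρ k))) hint
    simp only [LinearMap.comp_apply, LinearMap.mulLeft_apply, LinearMap.mulRight_apply] at this
    rw [this, ← integral_mul_left_eq_self (fun k => ρ k * (ρ k)ᵀ) k]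
    simp only [map_mul, transpose_mul, Matrix.mul_assoc]

theorem exists_posDef_of_isCompact [DecidableEq n] {G : Subgroup (SpecialLinearGroup n ℝ)}
    (hG : IsCompact (G : Set (SpecialLinearGroup n ℝ))) :
    ∃ S : Matrix n n ℝ, S.PosDef ∧ ∀ A ∈ G, (A : Matrix n n ℝ) * S * (A : Matrix n n ℝ)ᵀ = S := by
  have : CompactSpace G := isCompact_iff_compactSpace.1 hG
  have hcont : Continuous (SpecialLinearGroup.coeMonoidHom.comp G.subtype) :=
    continuous_subtype_val.comp continuous_subtype_val
  obtain ⟨S, hS, hinv⟩ := exists_posDef_mul_mul_transpose_eq hcont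
  exact ⟨S, hS, fun A hA => hinv ⟨A, hA⟩⟩

theorem exists_mul_norm_sq_le_dotProduct_mulVec {S : Matrix n n ℝ} (hS : S.PosDef) :
    ∃ m > 0, ∀ x : n → ℝ, m * ‖x‖ ^ 2 ≤ x ⬝ᵥ S *ᵥ x := by
  have hpos : ∀ x ∈ Metric.sphere (0 : n → ℝ) 1, 0 < x ⬝ᵥ S *ᵥ x := fun x hx => by
    simpa using hS.dotProduct_mulVec_pos (Metric.ne_of_mem_sphere hx one_ne_zero)
  obtain ⟨m, hm, hle⟩ := (isCompact_sphere (0 : n → ℝ) 1).exists_forall_le' (by fun_prop) hpos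
  refine ⟨m, hm, fun x => ?_⟩
  obtain rfl | hx := eq_or_ne x 0
  · simp
  have hunit : ‖x‖⁻¹ • x ∈ Metric.sphere (0 : n → ℝ) 1 := by
    simp [norm_smul, hx]
  have := hle _ hunit
  rw [mulVec_smul, smul_dotProduct, dotProduct_smul, smul_smul, ← mul_inv, smul_eq_mul] at this
  rwa [inv_mul_eq_div, le_div_iff₀ (by positivity), ← sq] at this

end CompactGroups

section EntireFunctions

open Filter Topology

theorem apply_eq_apply_of_isBigO_of_bounded_on_real {F : ℂ → ℂ} (hF : Differentiable ℂ F)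
    {c B M : ℝ} (hc : c < 1) (hgrowth : F =O[⊤] fun z => Real.exp (B * ‖z‖ ^ c))
    (hM : ∀ x : ℝ, ‖F x‖ ≤ M) (z w : ℂ) : F z = F w := by
  -- `F (w ^ 2)` has order less than `2` and is bounded on both axes, so Phragmen-Lindelöf applies
  -- in each quadrant.
  set G : ℂ → ℂ := fun w => F (w ^ 2) with hG
  have hGd : Differentiable ℂ G := hF.comp (by fun_prop)
  have hre (x : ℝ) : ‖G x‖ ≤ M := by
    have hsq : (x : ℂ) ^ 2 = ((x ^ 2 : ℝ) : ℂ) := by simp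
    simpa only [hG, hsq] using hM (x ^ 2)
  have him (x : ℝ) : ‖G (x * Complex.I)‖ ≤ M := by
    have hsq : (x * Complex.I) ^ 2 = ((-x ^ 2 : ℝ) : ℂ) := by simp [mul_pow]
    simpa only [hG, hsq] using hM (-x ^ 2)
  have hO (l : Filter ℂ) : ∃ c < (2 : ℝ), ∃ B, G =O[l] fun w => Real.exp (B * ‖w‖ ^ c) := by
    refine ⟨2 * c, by linarith, B, ?_⟩
    have hcomp := hgrowth.comp_tendsto (tendsto_top : Tendsto (fun w : ℂ => w ^ 2) l ⊤)
    refine hcomp.congr_right fun w => ?_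
    rw [Function.comp_apply, norm_pow, Real.rpow_mul (norm_nonneg w), Real.rpow_two]
  have hbounded (z : ℂ) : ‖G z‖ ≤ M := by
    rcases le_total 0 z.re with h1 | h1 <;> rcases le_total 0 z.im with h2 | h2
    · exact PhragmenLindelof.quadrant_I hGd.diffContOnCl (hO _) (fun x _ => hre x)
        (fun x _ => him x) h1 h2
    · exact PhragmenLindelof.quadrant_IV hGd.diffContOnCl (hO _) (fun x _ => hre x)
        (fun x _ => him x) h1 h2
    · exact PhragmenLindelof.quadrant_II hGd.diffContOnCl (hO _) (fun x _ => hre x)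
        (fun x _ => him x) h1 h2
    · exact PhragmenLindelof.quadrant_III hGd.diffContOnCl (hO _) (fun x _ => hre x)
        (fun x _ => him x) h1 h2
  obtain ⟨z', rfl⟩ := IsAlgClosed.exists_pow_nat_eq z two_pos
  obtain ⟨w', rfl⟩ := IsAlgClosed.exists_pow_nat_eq w two_pos
  refine hGd.apply_eq_apply_of_bounded ?_ z' w'
  exact isBounded_iff_forall_norm_le.2 ⟨M, Set.forall_mem_range.2 hbounded⟩

theorem eq_const_of_frequently_apply_ofReal_eq {F : ℂ → ℂ} (hF : Differentiable ℂ F) {c : ℂ}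
    {x₀ : ℝ} (hfreq : ∃ᶠ x : ℝ in 𝓝[≠] x₀, F x = c) (z : ℂ) : F z = c := by
  have hofReal : Tendsto ((↑) : ℝ → ℂ) (𝓝[≠] x₀) (𝓝[≠] (x₀ : ℂ)) :=
    tendsto_nhdsWithin_iff.2 ⟨Complex.continuous_ofReal.continuousWithinAt, by
      filter_upwards [self_mem_nhdsWithin] with x hx using by simpa using hx⟩
  exact congrFun (AnalyticOnNhd.eq_of_frequently_eq (fun z _ => hF.analyticAt z)
    (fun z _ => analyticAt_const) (hofReal.frequently hfreq)) z

theorem eq_of_frequently_dotProduct_mulVec_eq {n : Type*} [Fintype n] {F : n → ℂ → ℂ}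
    {r : ℝ → n → ℝ} {S : Matrix n n ℝ} {a c x₀ : ℝ} (hF : ∀ i, Differentiable ℂ (F i))
    (hFr : ∀ i (x : ℝ), F i x = r x i) (hc : c < 1)
    (hgrowth : ∀ i, ∃ B : ℝ, F i =O[⊤] fun z => Real.exp (B * ‖z‖ ^ c)) (hS : S.PosDef)
    (hfreq : ∃ᶠ x in 𝓝[≠] x₀, r x ⬝ᵥ S *ᵥ r x = a) (x y : ℝ) : r x = r y := by
  have hform (x : ℝ) : r x ⬝ᵥ S *ᵥ r x = a := by
    set Q : ℂ → ℂ := fun z => ∑ i, F i z * ∑ j, S i j * F j z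
    have hQr (x : ℝ) : Q x = (r x ⬝ᵥ S *ᵥ r x : ℝ) := by
      simp only [Q, hFr, dotProduct, mulVec]
      push_cast
      rfl
    have hQ : Differentiable ℂ Q := by fun_prop
    have := eq_const_of_frequently_apply_ofReal_eq hQ (c := a)
      (hfreq.mono fun x hx => by rw [hQr, hx]) x
    exact Complex.ofReal_injective ((hQr x).symm.trans this)
  obtain ⟨m, hm, hle⟩ := exists_mul_norm_sq_le_dotProduct_mulVec hS
  have hbound (x : ℝ) : ‖r x‖ ≤ √(a / m) :=
    Real.le_sqrt_of_sq_le ((le_div_iff₀' hm).2 ((hle _).trans_eq (hform x)))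
  ext i
  obtain ⟨B, hB⟩ := hgrowth i
  have hFi := apply_eq_apply_of_isBigO_of_bounded_on_real (hF i) hc hB (M := √(a / m))
    (fun x => by
      rw [hFr, Complex.norm_real]
      exact (norm_le_pi_norm _ i).trans (hbound x)) x y
  rw [hFr, hFr] at hFi
  exact Complex.ofReal_injective hFi

end EntireFunctions

section Noncompactness

open Filter Topology

variable {g h : ℝ → ℝ}

theorem ofReal_couplingTransferMatrix_zero_apply (hg : IntervalIntegrable g volume 0 1)
    (hh : IntervalIntegrable h volume 0 1) (η : ℝ) (i : Fin 2) :
    (couplingTransferMatrix hg hh η 0 i : ℂ) =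
      cauchySolution (fun t => (g t : ℂ) + η * h t)
        ((intervalIntegrable_ofReal hg).add ((intervalIntegrable_ofReal hh).const_mul (η : ℂ)))
        (Pi.single i 1) 1 := by
  have hentry : couplingTransferMatrix hg hh η 0 i =
      cauchySolution (fun t => g t + η * h t) (hg.add (hh.const_mul η)) (Pi.single i 1) 1 :=
    LinearMap.toMatrix'_apply _ _ _
  have hsingle : (fun j => ((Pi.single i 1 : Fin 2 → ℝ) j : ℂ)) = Pi.single i 1 := by
    ext j
    simp only [Pi.single_apply, apply_ite Complex.ofReal, Complex.ofReal_one, Complex.ofReal_zero]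
  have := congrArg (fun u : C(unitInterval, ℂ) => u 1)
    (complexify_cauchySolution (hg.add (hh.const_mul η)) (Pi.single i 1))
  rw [hentry]
  simpa only [complexify, ContinuousMap.coe_mk, Complex.ofReal_add, Complex.ofReal_mul,
    hsingle] using this

theorem row_eq_row_of_isCompact_of_frequently (hg : IntervalIntegrable g volume 0 1)
    (hh : IntervalIntegrable h volume 0 1) {G : Subgroup (SpecialLinearGroup (Fin 2) ℝ)}
    (hG : IsCompact (G : Set (SpecialLinearGroup (Fin 2) ℝ))) {η₀ : ℝ}
    (hfreq : ∃ᶠ η in 𝓝[≠] η₀, couplingTransferMatrix hg hh η ∈ G) (η η' : ℝ) :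
    couplingTransferMatrix hg hh η 0 = couplingTransferMatrix hg hh η' 0 := by
  obtain ⟨S, hS, hinv⟩ := exists_posDef_of_isCompact hG
  have hgC := intervalIntegrable_ofReal hg
  have hhC := intervalIntegrable_ofReal hh
  refine eq_of_frequently_dotProduct_mulVec_eq (c := 1 / 2) (a := S 0 0)
    (F := fun i z => cauchySolution (fun t => (g t : ℂ) + z * h t) (hgC.add (hhC.const_mul z))
      (Pi.single i 1) 1) (r := fun η => couplingTransferMatrix hg hh η 0)
    (fun i => ?_) (fun i η => (ofReal_couplingTransferMatrix_zero_apply hg hh η i).symm)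
    (by norm_num) (fun i => ?_) hS (hfreq.mono fun η hη => ?_) η η'
  · exact (ContinuousMap.evalCLM ℂ (1 : unitInterval)).differentiable.comp
      (differentiable_cauchySolution hgC hhC _)
  · obtain ⟨B, hB⟩ := isBigO_cauchySolution_add_mul hgC hhC (Pi.single i 1)
    exact ⟨B, (Asymptotics.IsBigO.of_norm_le fun z =>
      ContinuousMap.norm_coe_le_norm _ _).trans hB.norm_left⟩
  · conv_rhs => rw [← hinv _ hη]
    rw [Matrix.mul_assoc]
    rfl

theorem not_isCompact_of_frequently (hg : IntervalIntegrable g volume 0 1)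
    (hh : IntervalIntegrable h volume 0 1) (hh₀ : 0 ≤ᵐ[volume.restrict (Set.Ioc 0 1)] h)
    (hhne : ¬ h =ᵐ[volume.restrict (Set.Ioc 0 1)] 0)
    {G : Subgroup (SpecialLinearGroup (Fin 2) ℝ)} {η₀ : ℝ}
    (hfreq : ∃ᶠ η in 𝓝[≠] η₀, couplingTransferMatrix hg hh η ∈ G) :
    ¬ IsCompact (G : Set (SpecialLinearGroup (Fin 2) ℝ)) := by
  intro hG
  set r : Fin 2 → ℝ := couplingTransferMatrix hg hh η₀ 0
  have hr : r ≠ 0 := SpecialLinearGroup.row_ne_zero _ 0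
  have hv : ![-r 1, r 0] ≠ 0 := fun h₀ => hr <| by
    ext i
    fin_cases i
    exacts [congrFun h₀ 1, neg_eq_zero.1 (congrFun h₀ 0)]
  have hkill (η : ℝ) :
      ((couplingTransferMatrix hg hh η : Matrix (Fin 2) (Fin 2) ℝ) *ᵥ ![-r 1, r 0]) 0 = 0 := by
    have hrow := row_eq_row_of_isCompact_of_frequently hg hh hG hfreq η η₀
    rw [mulVec, hrow]
    simp [dotProduct, r, mul_comm]
  obtain ⟨η, hη⟩ :=
    (eventually_linearIndependent_couplingTransferMatrix_mulVec hg hh hh₀ hhne hv η₀).exists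
  rw [linearIndependent_pair_iff_det_ne_zero, hkill, hkill, zero_mul, mul_zero, sub_zero] at hη
  exact hη rfl

end Noncompactness

section SingleSitePotential

variable {f : ℝ → ℝ}

theorem intervalIntegrable_of_mem_Icc {a b m M : ℝ} (hf : AEMeasurable f)
    (hmM : ∀ x, f x ∈ Set.Icc m M) : IntervalIntegrable f volume a b :=
  ⟨.of_mem_Icc m M hf.restrict (.of_forall hmM), .of_mem_Icc m M hf.restrict (.of_forall hmM)⟩

theorem volume_Ioc_inter_pos {J : Set ℝ} (hJ : J.OrdConnected) (hJn : J.Nontrivial)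
    {a b : ℝ} (hJab : J ⊆ Set.Icc a b) : 0 < volume (Set.Ioc a b ∩ J) := by
  obtain ⟨x, hx, y, hy, hxy⟩ := hJn.exists_lt
  refine (?_ : 0 < volume (Set.Ioc x y)).trans_le (measure_mono fun z hz => ⟨?_, ?_⟩)
  · simpa using hxy
  · exact ⟨(hJab hx).1.trans_lt hz.1, hz.2.trans (hJab hy).2⟩
  · exact hJ.out hx hy (Set.Ioc_subset_Icc_self hz)

theorem not_ae_eq_zero_of_indicator_le {J : Set ℝ} (hJ : J.OrdConnected) (hJn : J.Nontrivial)
    {a b c : ℝ} (hJab : J ⊆ Set.Icc a b) (hc : 0 < c)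
    (hf : ∀ x, J.indicator (fun _ => c) x ≤ f x) :
    ¬ f =ᵐ[volume.restrict (Set.Ioc a b)] 0 := by
  intro h₀
  refine (volume_Ioc_inter_pos hJ hJn hJab).ne' (measure_mono_null ?_
    ((ae_restrict_iff' measurableSet_Ioc).1 h₀))
  rintro x ⟨hx, hxJ⟩ hfx
  have := hf x
  rw [Set.indicator_of_mem hxJ, hfx hx] at this
  exact hc.not_ge this

end SingleSitePotential

theorem couplingTransferMatrix_mem_furstenbergGroup {W f : ℝ → ℝ} {μ : Measure ℝ} {E η : ℝ}
    (hW : IntervalIntegrable (fun x => W x - E) volume 0 1)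
    (hf : IntervalIntegrable f volume 0 1) (hη : η ∈ μ.support) :
    couplingTransferMatrix hW hf η ∈ furstenbergGroup W f μ E := by
  refine Subgroup.le_topologicalClosure _ (Subgroup.subset_closure ⟨η, hη, ?_⟩)
  simp only [add_sub_right_comm]
  exact isTransferMatrix_transferMatrix (hW.add (hf.const_mul η))

theorem mainTheorem3_general {W f : ℝ → ℝ} (hW : IntervalIntegrable W volume 0 1)
    (hf : IntervalIntegrable f volume 0 1) (hf₀ : 0 ≤ᵐ[volume.restrict (Set.Ioc 0 1)] f)
    (hfne : ¬ f =ᵐ[volume.restrict (Set.Ioc 0 1)] 0) {μ : Measure ℝ}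
    (hμ : ¬ IsDiscrete μ.support) (E : ℝ) :
    ¬ IsCompact (furstenbergGroup W f μ E : Set (SpecialLinearGroup (Fin 2) ℝ)) ∧
      IsStronglyIrreducible (furstenbergGroup W f μ E : Set (SpecialLinearGroup (Fin 2) ℝ)) := by
  have hWE : IntervalIntegrable (fun x => W x - E) volume 0 1 := hW.sub intervalIntegrable_const
  obtain ⟨η₀, -, hη₀⟩ := exists_frequently_mem_of_not_isDiscrete hμ
  have hmem := hη₀.mono fun η hη => couplingTransferMatrix_mem_furstenbergGroup hWE hf hη
  exact ⟨not_isCompact_of_frequently hWE hf hf₀ hfne hmem, isStronglyIrreducible_of_frequently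
    (fun v => (continuous_couplingTransferMatrix_mulVec hWE hf v).continuousAt)
    (fun v hv => eventually_linearIndependent_couplingTransferMatrix_mulVec hWE hf hf₀ hfne hv η₀)
    hmem⟩

theorem mainTheorem3
    (W : ℝ → ℝ) (hW_meas : AEMeasurable W) (hW_bdd : ∃ B : ℝ, ∀ x, |W x| ≤ B)
    (hW_per : Function.Periodic W 1)
    (f : ℝ → ℝ) (hf_meas : AEMeasurable f)
    (J : Set ℝ) (hJ_interval : J.OrdConnected) (hJ_nontrivial : J.Nontrivial)
    (hJ_sub : J ⊆ Set.Icc 0 1)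
    (c C : ℝ) (hc : 0 < c) (hcC : c ≤ C)
    (hf_lower : ∀ x, J.indicator (fun _ => c) x ≤ f x)
    (hf_upper : ∀ x, f x ≤ (Set.Icc (0 : ℝ) 1).indicator (fun _ => C) x)
    (μ : Measure ℝ) [IsProbabilityMeasure μ] (hμ : ¬ IsDiscrete μ.support) (E : ℝ) :
    ¬ IsCompact (furstenbergGroup W f μ E : Set (SpecialLinearGroup (Fin 2) ℝ)) ∧
      IsStronglyIrreducible (furstenbergGroup W f μ E : Set (SpecialLinearGroup (Fin 2) ℝ)) := by
  obtain ⟨B, hB⟩ := hW_bdd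
  have hf (x : ℝ) : f x ∈ Set.Icc 0 C :=
    ⟨(Set.indicator_nonneg (fun _ _ => hc.le) x).trans (hf_lower x),
      (hf_upper x).trans (Set.indicator_le_self' (fun _ _ => hc.le.trans hcC) x)⟩
  exact mainTheorem3_general (intervalIntegrable_of_mem_Icc hW_meas fun x => abs_le.1 (hB x))
    (intervalIntegrable_of_mem_Icc hf_meas hf) (.of_forall fun x => (hf x).1)
    (not_ae_eq_zero_of_indicator_le hJ_interval hJ_nontrivial hJ_sub hc hf_lower) hμ E
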